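/- Let $\mathcal X$ be a finite alphabet with $q=|\mathcal X|$, let $P_0,P_1$ be probability distributions on $\mathcal X$, let $\varepsilon>0$, and let $n\in\mathbb N$. The randomized response mechanism is the channel $W(y\mid x)=\frac{e^{\varepsilon}}{e^{\varepsilon}+q-1}$ if $y=x$ and $W(y\mid x)=\frac{1}{e^{\varepsilon}+q-1}$ if $y\neq x$, for $x,y\in\mathcal X$; let $Q_j(y)=\sum_{x}P_j(x)W(y\mid x)$, $j\in\{0,1\}$. The offline RR-CPD algorithm passes each point $x_i$ of a dataset $(x_1,\dots,x_n)\in\mathcal X^n$ independently through $W$ to get $y_i$, and outputs an estimate $$\hat k\in\arg\max_{k\in\{1,\dots,n\}}\ \sum_{i=k}^{n}\log\frac{Q_1(y_i)}{Q_0(y_i)},$$ a function of $(y_1,\dots,y_n)$, with ties broken in any way. Then the algorithm is $\varepsilon$-locally differentially private: $W(S\mid x)\le e^{\varepsilon}\,W(S\mid x')$ for all $x,x'\in\mathcal X$ and all $S\subseteq\mathcal X$, where $W$ is the mechanism applied to every data point. Moreover, let $k^\star\in\{2,\dots,n\}$ and let the data points be independent with $x_i\sim P_0$ for $i<k^\star$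 and $x_i\sim P_1$ for $i\ge k^\star$. Then, for every $\alpha\in\{1,\dots,n\}$, the algorithm is $(\alpha,\beta_r)$-accurate, i.e. $\mathbb P\{\hat k\notin[k^\star-\alpha,k^\star+\alpha]\}=\beta_r$, for some $\beta_r$ with $$\beta_r\le 2\min\left\{\sum_{i=1}^{i^*}\exp\left(-\frac{2^{i-1}\alpha\,C_r^2}{s_r^2}\right);\ \left(1-\frac{C_r}{2}\right)^{\alpha/2}\right\},$$ where $$i^*=\left\lceil\log_2\frac{n-1}{\alpha}\right\rceil,\quad s_r=\min\{2\varepsilon,\ \tanh(\varepsilon/2)\,s\},\quad C_r=2\left(\frac{e^{\varepsilon}-1}{e^{\varepsilon}+q-1}\right)^2 d_{\mathrm{TV}}^2(P_0,P_1),$$ $d_{\mathrm{TV}}(P_0,P_1)=\frac12\sum_{x}|P_0(x)-P_1(x)|$, and $s=D_\infty(P_1\|P_0)+D_\infty(P_0\|P_1)\in[0,\infty]$ with $D_\infty(P\|Q)=\max_{x:\,P(x)>0}\log\frac{P(x)}{Q(x)}$ (so $s=\max_x\log\frac{P_1(x)}{P_0(x)}-\min_x\log\frac{P_1(x)}{P_0(x)}$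 when $P_0,P_1$ have full support, and $s_r=2\varepsilon$ when $s=\infty$). A sum over an empty range ($i^*\le 0$) is $0$, and if $P_0=P_1$, where $C_r=s_r=0$, the quotient $C_r^2/s_r^2$ is read as $0$. -/

import Mathlib

open scoped ENNReal

noncomputable section

namespace LocalCPD

/-- Total variation distance on a finite alphabet, `(1/2) ∑ |P x - Q x|`. -/
def tvDist {X : Type*} [Fintype X] (P Q : PMF X) : ℝ :=
  (1 / 2) * ∑ x, |(P x).toReal - (Q x).toReal|

/-- Rényi divergence of order infinity, `max_x log (P x / Q x)`, as an extended real number.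
In `ℝ≥0∞` one has `a / 0 = ∞` for `a ≠ 0` and `0 / 0 = 0`, with `log 0 = -∞` and `log ∞ = ∞`.
So points with `P x = 0` do not contribute, and a point with `P x > 0 = Q x` gives `∞`. -/
def renyiDivInf {X : Type*} (P Q : PMF X) : EReal :=
  ⨆ x, ENNReal.log (P x / Q x)

/-- The sensitivity of the likelihood ratio statistic, that is, the Jeffreys-Rényi divergence of
order infinity: `max log (P₁ / P₀) - min log (P₁ / P₀)`, which is `∞` if the supports differ. -/
def sensitivity {X : Type*} (P₀ P₁ : PMF X) : EReal :=
  renyiDivInf P₁ P₀ + renyiDivInf P₀ P₁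

/-- Transition probability `W(y | x)` of the randomized response mechanism, `q = |X|`. -/
def rrProb {X : Type*} [Fintype X] [DecidableEq X] (ε : ℝ) (x y : X) : ℝ :=
  if y = x then Real.exp ε / (Real.exp ε + Fintype.card X - 1)
  else 1 / (Real.exp ε + Fintype.card X - 1)

theorem rr_denom_pos {X : Type*} [Fintype X] (ε : ℝ) (x : X) :
    0 < Real.exp ε + Fintype.card X - 1 := by
  have h : 0 < Fintype.card X := Fintype.card_pos_iff.mpr ⟨x⟩
  have h1 : (1 : ℝ) ≤ Fintype.card X := by exact_mod_cast h
  have := Real.exp_pos ε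
  linarith

theorem rrProb_nonneg {X : Type*} [Fintype X] [DecidableEq X] (ε : ℝ) (x y : X) :
    0 ≤ rrProb ε x y := by
  have := rr_denom_pos ε x
  unfold rrProb
  split_ifs <;> positivity

theorem sum_rrProb {X : Type*} [Fintype X] [DecidableEq X] (ε : ℝ) (x : X) :
    ∑ y, rrProb ε x y = 1 := by
  have hd := rr_denom_pos ε x
  have h : ∀ y, rrProb ε x y = 1 / (Real.exp ε + Fintype.card X - 1) +
      (if y = x then (Real.exp ε - 1) / (Real.exp ε + Fintype.card X - 1) else 0) := by
    intro y
    unfold rrProb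
    split_ifs
    · rw [← add_div]; ring
    · ring
  simp_rw [h]
  rw [Finset.sum_add_distrib, Finset.sum_ite_eq' Finset.univ x]
  simp only [Finset.sum_const, Finset.card_univ, nsmul_eq_mul, Finset.mem_univ, if_true]
  field_simp
  ring

/-- The randomized response mechanism as a channel from `X` to `X`. -/
def randomizedResponse {X : Type*} [Fintype X] [DecidableEq X] (ε : ℝ) (x : X) : PMF X :=
  PMF.ofFintype (fun y => ENNReal.ofReal (rrProb ε x y)) (by
    rw [← ENNReal.ofReal_sum_of_nonneg (fun y _ => rrProb_nonneg ε x y), sum_rrProb,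
      ENNReal.ofReal_one])

/-- `ε`-local differential privacy of a mechanism (channel) `W` from `X` to `Y`. -/
def IsLDP {X Y : Type*} (ε : ℝ) (W : X → PMF Y) : Prop :=
  ∀ (x x' : X) (S : Set Y),
    (W x).toOuterMeasure S ≤ ENNReal.ofReal (Real.exp ε) * (W x').toOuterMeasure S

/-- A change-point detection algorithm in the local model. Each data point is privatized by its
owner with the mechanism `privatizer`; the analyst then estimates the change-point, an element of
`{1, …, n}`, from the privatized dataset only. The data point number `j ∈ {1, …, n}` sits at the
index `i : Fin n` with `i + 1 = j`. -/
structure Algorithm (X Y : Type*) (n : ℕ) where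
  privatizer : X → PMF Y
  estimator : (Fin n → Y) → ℕ

/-- A local algorithm is `ε`-LDP if the mechanism that acts on every single data point is. -/
def Algorithm.IsLDP {X Y : Type*} {n : ℕ} (A : Algorithm X Y n) (ε : ℝ) : Prop :=
  LocalCPD.IsLDP ε A.privatizer

/-- Law of a dataset of size `n` with true change-point `kstar`: independent data points,
`x_j ∼ P₀` for `j < kstar` and `x_j ∼ P₁` for `kstar ≤ j ≤ n`. -/
def datasetLaw {X : Type*} [MeasurableSpace X] (P₀ P₁ : PMF X) (n kstar : ℕ) :
    MeasureTheory.Measure (Fin n → X) :=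
  MeasureTheory.Measure.pi fun i => (if (i : ℕ) + 1 < kstar then P₀ else P₁).toMeasure

/-- Law of the privatized dataset for a fixed dataset `x`: the data points are passed
independently through the mechanism. -/
def Algorithm.privatize {X Y : Type*} [MeasurableSpace Y] {n : ℕ} (A : Algorithm X Y n)
    (x : Fin n → X) : MeasureTheory.Measure (Fin n → Y) :=
  MeasureTheory.Measure.pi fun i => (A.privatizer (x i)).toMeasure

/-- Law of the privatized dataset when the dataset is random with change-point `kstar`. -/
def Algorithm.privatizedLaw {X Y : Type*} [MeasurableSpace X] [MeasurableSpace Y] {n : ℕ}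
    (A : Algorithm X Y n) (P₀ P₁ : PMF X) (kstar : ℕ) : MeasureTheory.Measure (Fin n → Y) :=
  (datasetLaw P₀ P₁ n kstar).bind A.privatize

/-- The algorithm is `(α, β)`-accurate for the change-point `kstar` if the probability that the
estimate falls outside `[kstar - α, kstar + α]` equals `β`. -/
def Algorithm.IsAccurate {X Y : Type*} [MeasurableSpace X] [MeasurableSpace Y] {n : ℕ}
    (A : Algorithm X Y n) (P₀ P₁ : PMF X) (kstar α : ℕ) (β : ℝ) : Prop :=
  (A.privatizedLaw P₀ P₁ kstar).real
    {y | ((A.estimator y : ℕ) : ℤ) ∉ Set.Icc ((kstar : ℤ) - α) ((kstar : ℤ) + α)} = β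

/-- Log-likelihood ratio statistic `l(y, k) = ∑_{j = k}^n log (Q₁ (y_j) / Q₀ (y_j))`. -/
def logLR {Y : Type*} {n : ℕ} (Q₀ Q₁ : PMF Y) (y : Fin n → Y) (k : ℕ) : ℝ :=
  ∑ i : Fin n,
    if k ≤ (i : ℕ) + 1 then Real.log ((Q₁ (y i)).toReal / (Q₀ (y i)).toReal) else 0

/-- `khat` is an offline (generalized likelihood ratio) estimator for `(Q₀, Q₁)`: it returns a
maximizer of `l(y, ·)` on `{1, …, n}`. Ties may be broken in any way. -/
def IsOfflineCPD {Y : Type*} {n : ℕ} (Q₀ Q₁ : PMF Y) (khat : (Fin n → Y) → ℕ) : Prop :=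
  ∀ y, khat y ∈ Set.Icc 1 n ∧ ∀ k ∈ Set.Icc 1 n, logLR Q₀ Q₁ y k ≤ logLR Q₀ Q₁ y (khat y)

/-- `A` is the randomized response change-point detection algorithm: it privatizes with randomized
response and runs the offline estimator on the privatized data, for the output distributions
`Q i = ∑ x, P i x * W(· | x)` (this is `PMF.bind`). -/
def IsRRCPD {X : Type*} [Fintype X] [DecidableEq X] {n : ℕ} (ε : ℝ) (P₀ P₁ : PMF X)
    (A : Algorithm X X n) : Prop :=
  A.privatizer = randomizedResponse ε ∧
    IsOfflineCPD (P₀.bind (randomizedResponse ε)) (P₁.bind (randomizedResponse ε)) A.estimator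

/-- `s_r = min {2 ε, tanh (ε / 2) s}`. The minimum is taken in the extended reals (it is `2 ε` for
`s = ∞`) and is finite. -/
def sR {X : Type*} (ε : ℝ) (P₀ P₁ : PMF X) : ℝ :=
  (min ((2 * ε : ℝ) : EReal) ((Real.tanh (ε / 2) : ℝ) * sensitivity P₀ P₁)).toReal

/-- `C_r = 2 ((e^ε - 1) / (e^ε + q - 1))² d_TV(P₀, P₁)²`, with `q = |X|`. -/
def cR {X : Type*} [Fintype X] (ε : ℝ) (P₀ P₁ : PMF X) : ℝ :=
  2 * ((Real.exp ε - 1) / (Real.exp ε + Fintype.card X - 1)) ^ 2 * tvDist P₀ P₁ ^ 2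

/-- `i^* = ⌈log₂ ((n - 1) / α)⌉`, with negative values replaced by `0` (either way the sum over
`1 ≤ i ≤ i^*` is empty). -/
def iStar (n α : ℕ) : ℕ := ⌈Real.logb 2 (((n : ℝ) - 1) / α)⌉₊

end LocalCPD

end

/-! After privatization the points are independent, with law `Q₀` before the change and `Q₁` from it
on. If the maximizer misses by more than `α`, then one of two walks started at the change-point,
leftwards with steps `log (Q₁ / Q₀)` or rightwards with steps `log (Q₀ / Q₁)`, is nonnegative at
some time at least `α + 1`. Exponentiated with factor 1/2, each walk is a product of independent
factors whose mean is the Bhattacharyya coefficient, at most `ρ = √(1 - T²)` with `T = d_TV(Q₀,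
Q₁)`. A Ville-type inequality, `measure_exists_one_le_prod_le`, bounds each probability by `ρ ^ (α +
1)`. Since `C_r = 2 T²`, this gives the second term of the minimum.

The first term is weaker: its summand `i = 1` already exceeds `(1 - T²) ^ (α / 2)`, because `4 T ≤
s_r` (`four_mul_tvDist_le_sR`). That rests on the contraction of total variation under randomized
response and on `4 d_TV ≤ s`. If the sum is empty, the error event is empty too. -/

namespace LocalCPD

open MeasureTheory

/-! ### Maximal inequality for products of independent factors -/

section Ville

variable {ι X : Type*}

/-- The product process `∏_{j < m} g (y (e j))`, stopped at the first time `m ≥ a` at which it is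
at least `1`. -/
noncomputable def stoppedProd (g : X → ℝ≥0∞) (e : ℕ → ι) (a : ℕ) : ℕ → (ι → X) → ℝ≥0∞
  | 0, _ => 1
  | m + 1, y => if a ≤ m ∧ 1 ≤ stoppedProd g e a m y then stoppedProd g e a m y
      else stoppedProd g e a m y * g (y (e m))

theorem stoppedProd_update [DecidableEq ι] (g : X → ℝ≥0∞) (e : ℕ → ι) (a m : ℕ) (y : ι → X) (i : ι)
    (t : X) (h : ∀ j < m, e j ≠ i) :
    stoppedProd g e a m (Function.update y i t) = stoppedProd g e a m y := by
  induction m with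
  | zero => rfl
  | succ m ih =>
    have h1 := ih fun j hj => h j (hj.trans m.lt_succ_self)
    simp only [stoppedProd, h1, Function.update_of_ne (h m m.lt_succ_self)]

theorem one_le_stoppedProd_of_le {g : X → ℝ≥0∞} {e : ℕ → ι} {a m M : ℕ} {y : ι → X} (ham : a ≤ m)
    (hm : 1 ≤ stoppedProd g e a m y) (hmM : m ≤ M) : 1 ≤ stoppedProd g e a M y := by
  induction M, hmM using Nat.le_induction with
  | base => exact hm
  | succ k hk ih =>
    rw [stoppedProd, if_pos ⟨ham.trans hk, ih⟩]
    exact ih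

theorem stoppedProd_eq_prod_or (g : X → ℝ≥0∞) (e : ℕ → ι) (a m : ℕ) (y : ι → X) :
    stoppedProd g e a m y = ∏ j ∈ Finset.range m, g (y (e j)) ∨
      a ≤ m ∧ 1 ≤ stoppedProd g e a m y := by
  induction m with
  | zero => left; simp [stoppedProd]
  | succ m ih =>
    by_cases hs : a ≤ m ∧ 1 ≤ stoppedProd g e a m y
    · exact Or.inr ⟨hs.1.trans m.le_succ, one_le_stoppedProd_of_le hs.1 hs.2 m.le_succ⟩
    · left
      rw [stoppedProd, if_neg hs, Finset.prod_range_succ, ih.resolve_right hs]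

/-- Stopping freezes a value that is at least 1, so a crossing at any time in `[a, M]` is still
visible at time `M`, where Markov's inequality applies. -/
theorem one_le_stoppedProd {g : X → ℝ≥0∞} {e : ℕ → ι} {a m M : ℕ} {y : ι → X} (ham : a ≤ m)
    (hmM : m ≤ M) (h : 1 ≤ ∏ j ∈ Finset.range m, g (y (e j))) : 1 ≤ stoppedProd g e a M y := by
  rcases stoppedProd_eq_prod_or g e a m y with h1 | h1
  · exact one_le_stoppedProd_of_le ham (h1 ▸ h) hmM
  · exact one_le_stoppedProd_of_le h1.1 h1.2 hmM

variable [Fintype ι] [Finite X] [MeasurableSpace X] [MeasurableSingletonClass X]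
  (μ : ι → Measure X) [∀ i, IsProbabilityMeasure (μ i)]

theorem lintegral_pi_mul_coord (f : (ι → X) → ℝ≥0∞) (g : X → ℝ≥0∞) (i : ι) [DecidableEq ι]
    (hf : ∀ y t, f (Function.update y i t) = f y) :
    ∫⁻ y, f y * g (y i) ∂Measure.pi μ = (∫⁻ y, f y ∂Measure.pi μ) * ∫⁻ t, g t ∂μ i := by
  rw [← lintegral_mul_const _ (measurable_of_finite f)]
  refine lintegral_eq_of_lmarginal_eq {i} (measurable_of_finite _) (measurable_of_finite _) ?_
  ext y
  simp only [lmarginal_singleton, hf, Function.update_self]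
  rw [lintegral_const_mul _ (measurable_of_finite g), lintegral_const, measure_univ, mul_one]

/-- The decision to stop at time `m` depends only on earlier coordinates, so the new factor is
independent of the part still running. Before time `a` nothing stops and the whole mean is gained;
afterwards the integral merely does not increase. -/
theorem lintegral_stoppedProd_succ_le {g : X → ℝ≥0∞} {e : ℕ → ι} {m : ℕ} (a : ℕ)
    (he : ∀ j < m, e j ≠ e m) (hg : ∫⁻ t, g t ∂μ (e m) ≤ 1) :
    ∫⁻ y, stoppedProd g e a (m + 1) y ∂Measure.pi μ ≤
      (if m < a then ∫⁻ t, g t ∂μ (e m) else 1) * ∫⁻ y, stoppedProd g e a m y ∂Measure.pi μ := by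
  classical
  split_ifs with hma
  · rw [mul_comm, ← lintegral_pi_mul_coord μ _ g (e m)
      fun y t => stoppedProd_update g e a m y (e m) t he]
    refine le_of_eq (lintegral_congr fun y => ?_)
    rw [stoppedProd, if_neg fun h => absurd h.1 (not_le.2 hma)]
  · set f₁ : (ι → X) → ℝ≥0∞ := fun y =>
      if a ≤ m ∧ 1 ≤ stoppedProd g e a m y then stoppedProd g e a m y else 0 with hf₁
    set f₂ : (ι → X) → ℝ≥0∞ := fun y =>
      if a ≤ m ∧ 1 ≤ stoppedProd g e a m y then 0 else stoppedProd g e a m y with hf₂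
    have h₁ : ∀ y, stoppedProd g e a (m + 1) y = f₁ y + f₂ y * g (y (e m)) := by
      intro y
      simp only [stoppedProd, hf₁, hf₂]
      split_ifs <;> simp
    have h₂ : ∀ y, stoppedProd g e a m y = f₁ y + f₂ y := by
      intro y
      simp only [hf₁, hf₂]
      split_ifs <;> simp
    simp_rw [h₁]
    rw [one_mul, lintegral_congr h₂, lintegral_add_left (measurable_of_finite _),
      lintegral_add_left (measurable_of_finite _), lintegral_pi_mul_coord μ f₂ g (e m) fun y t => by
        simp only [hf₂, stoppedProd_update g e a m y (e m) t he]]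
    gcongr
    exact mul_le_of_le_one_right' hg

theorem lintegral_stoppedProd_le {g : X → ℝ≥0∞} {e : ℕ → ι} {a M : ℕ} {ρ : ℝ≥0∞} (hρ : ρ ≤ 1)
    (he : Set.InjOn e (Set.Iio M)) (hg : ∀ m < M, ∫⁻ t, g t ∂μ (e m) ≤ ρ) :
    ∫⁻ y, stoppedProd g e a M y ∂Measure.pi μ ≤ ρ ^ (min M a) := by
  induction M with
  | zero => simp [stoppedProd]
  | succ m ih =>
    have hg' := hg m m.lt_succ_self
    have hne : ∀ j < m, e j ≠ e m := fun j hj h =>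
      hj.ne (he (hj.trans m.lt_succ_self) m.lt_succ_self h)
    have ih' := ih (he.mono (Set.Iio_subset_Iio m.le_succ)) fun j hj => hg j (hj.trans m.lt_succ_self)
    refine (lintegral_stoppedProd_succ_le μ a hne (hg'.trans hρ)).trans ?_
    split_ifs with hma
    · rw [min_eq_left hma.le] at ih'
      rw [min_eq_left (Nat.succ_le_of_lt hma), pow_succ']
      gcongr
    · rw [not_lt] at hma
      rw [min_eq_right hma] at ih'
      rwa [min_eq_right (hma.trans m.le_succ), one_mul]

/-- Maximal inequality for a product of independent factors with mean at most `ρ ≤ 1`. -/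
theorem measure_exists_one_le_prod_le {g : X → ℝ≥0∞} {e : ℕ → ι} {a M : ℕ} {ρ : ℝ≥0∞}
    (hρ : ρ ≤ 1) (he : Set.InjOn e (Set.Iio M)) (hg : ∀ m < M, ∫⁻ t, g t ∂μ (e m) ≤ ρ) :
    Measure.pi μ {y | ∃ m, a ≤ m ∧ m ≤ M ∧ 1 ≤ ∏ j ∈ Finset.range m, g (y (e j))} ≤ ρ ^ a := by
  rcases lt_or_ge M a with h | h
  · have : {y : ι → X | ∃ m, a ≤ m ∧ m ≤ M ∧ 1 ≤ ∏ j ∈ Finset.range m, g (y (e j))} = ∅ := by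
      ext y
      simp only [Set.mem_ofPred_eq, Set.mem_empty_iff_false, iff_false]
      rintro ⟨m, h1, h2, -⟩
      omega
    simp [this]
  calc _ ≤ Measure.pi μ {y | 1 ≤ stoppedProd g e a M y} :=
        measure_mono (by
          rintro y ⟨m, h1, h2, h3⟩
          exact one_le_stoppedProd h1 h2 h3)
    _ ≤ ∫⁻ y, stoppedProd g e a M y ∂Measure.pi μ := by
        simpa using mul_meas_ge_le_lintegral (μ := Measure.pi μ)
          (measurable_of_finite (stoppedProd g e a M)) 1
    _ ≤ ρ ^ a := by simpa [h] using lintegral_stoppedProd_le (a := a) μ hρ he hg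

end Ville

/-! ### Law of the privatized dataset -/

theorem privatizedLaw_eq_pi {X Y : Type*} [Finite X] [Finite Y] [MeasurableSpace X]
    [MeasurableSingletonClass X] [MeasurableSpace Y] [MeasurableSingletonClass Y] {n : ℕ}
    (A : Algorithm X Y n) (P₀ P₁ : PMF X) (kstar : ℕ) :
    A.privatizedLaw P₀ P₁ kstar = Measure.pi fun i : Fin n =>
      (if (i : ℕ) + 1 < kstar then P₀.bind A.privatizer else P₁.bind A.privatizer).toMeasure := by
  classical
  have := Fintype.ofFinite X
  refine Measure.ext_of_singleton fun y => ?_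
  rw [Algorithm.privatizedLaw, datasetLaw,
    Measure.bind_apply (measurableSet_singleton y) (measurable_of_finite _).aemeasurable,
    lintegral_fintype, Measure.pi_singleton]
  simp_rw [Algorithm.privatize, Measure.pi_singleton, ← Finset.prod_mul_distrib]
  -- The sum over all datasets of a product over coordinates factors into a product of sums.
  rw [← Fintype.piFinset_univ, ← Finset.prod_univ_sum (fun _ => Finset.univ)
    fun i x => (A.privatizer x).toMeasure {y i} *
      (if (i : ℕ) + 1 < kstar then P₀ else P₁).toMeasure {x}]
  refine Finset.prod_congr rfl fun i _ => ?_
  simp only [PMF.toMeasure_apply_singleton _ _ (measurableSet_singleton _)]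
  split_ifs <;> simp [PMF.bind_apply, tsum_fintype, mul_comm]

end LocalCPD

namespace LocalCPD

/-! ### Real inequalities for total variation -/

section Analysis

/-- This is `log (1 + t) ≥ 2 t / (t + 2)` at `t = (u - v) / v`. -/
theorem two_mul_sub_le_mul_add {u v b : ℝ} (hv : 0 < v) (hvu : v ≤ u) (hu : u ≤ Real.exp b * v) :
    2 * (u - v) ≤ b * (u + v) := by
  have h1 : 0 ≤ (u - v) / v := div_nonneg (sub_nonneg.2 hvu) hv.le
  have h2 := Real.le_log_one_add_of_nonneg h1
  have h3 : Real.log (1 + (u - v) / v) ≤ b := by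
    rw [Real.log_le_iff_le_exp (by positivity)]
    have : 1 + (u - v) / v = u / v := by field_simp; ring
    rw [this, div_le_iff₀ hv]
    exact hu
  have h4 : 2 * ((u - v) / v) / ((u - v) / v + 2) = 2 * (u - v) / (u + v) := by
    have : (u - v) / v + 2 = (u + v) / v := by field_simp; ring
    rw [this]
    field_simp
  have h5 := h2.trans h3
  rwa [h4, div_le_iff₀ (by linarith)] at h5

variable {X : Type*} [Fintype X] {p q : X → ℝ}

/-- The total variation distance is at most a quarter of the Hilbert projective distance. -/
theorem two_mul_sum_abs_sub_le {a b : ℝ} (hp1 : ∑ x, p x = 1)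
    (hq1 : ∑ x, q x = 1) (hq : ∀ x, 0 ≤ q x) (h1 : ∀ x, p x ≤ Real.exp b * q x)
    (h2 : ∀ x, q x ≤ Real.exp a * p x) : 2 * ∑ x, |p x - q x| ≤ a + b := by
  classical
  -- Merging the points of `S` and those of its complement reduces the claim to two-point
  -- distributions `(u, 1 - u)` and `(v, 1 - v)` without changing the total variation.
  set S := Finset.univ.filter fun x => q x < p x with hS
  set u := ∑ x ∈ S, p x with hu
  set v := ∑ x ∈ S, q x with hv
  have hpc : ∑ x ∈ Sᶜ, p x = 1 - u := by rw [← hp1, ← Finset.sum_add_sum_compl S p]; ring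
  have hqc : ∑ x ∈ Sᶜ, q x = 1 - v := by rw [← hq1, ← Finset.sum_add_sum_compl S q]; ring
  have habs : ∑ x, |p x - q x| = 2 * (u - v) := by
    rw [← Finset.sum_add_sum_compl S]
    have e1 : ∑ x ∈ S, |p x - q x| = u - v := by
      rw [hu, hv, ← Finset.sum_sub_distrib]
      refine Finset.sum_congr rfl fun x hx => abs_of_nonneg ?_
      simp [hS] at hx
      linarith
    have e2 : ∑ x ∈ Sᶜ, |p x - q x| = (1 - v) - (1 - u) := by
      rw [← hpc, ← hqc, ← Finset.sum_sub_distrib]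
      refine Finset.sum_congr rfl fun x hx => ?_
      rw [abs_sub_comm]
      refine abs_of_nonneg ?_
      simp [hS] at hx
      linarith
    rw [e1, e2]; ring
  have huv : u ≤ Real.exp b * v := by
    rw [hu, hv, Finset.mul_sum]; exact Finset.sum_le_sum fun x _ => h1 x
  have hvu : 1 - v ≤ Real.exp a * (1 - u) := by
    rw [← hpc, ← hqc, Finset.mul_sum]; exact Finset.sum_le_sum fun x _ => h2 x
  have hv0 : 0 ≤ v := Finset.sum_nonneg fun x _ => hq x
  have hv1 : 0 ≤ 1 - v := hqc ▸ Finset.sum_nonneg fun x _ => hq x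
  have hle : v ≤ u := Finset.sum_le_sum fun x hx => by simp [hS] at hx; exact hx.le
  have hb0 : 0 ≤ b := by
    rw [← Real.one_le_exp_iff]
    calc (1 : ℝ) = ∑ x, p x := hp1.symm
      _ ≤ ∑ x, Real.exp b * q x := Finset.sum_le_sum fun x _ => h1 x
      _ = Real.exp b := by rw [← Finset.mul_sum, hq1, mul_one]
  have ha0 : 0 ≤ a := by
    rw [← Real.one_le_exp_iff]
    calc (1 : ℝ) = ∑ x, q x := hq1.symm
      _ ≤ ∑ x, Real.exp a * p x := Finset.sum_le_sum fun x _ => h2 x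
      _ = Real.exp a := by rw [← Finset.mul_sum, hp1, mul_one]
  rw [habs]
  rcases hle.eq_or_lt with heq | hlt
  · rw [heq]; linarith
  have hvpos : 0 < v := by
    rcases hv0.eq_or_lt with h | h
    · rw [← h] at huv hlt; simp at huv; linarith
    · exact h
  have hu1 : 0 ≤ 1 - u := hpc ▸ Finset.sum_nonneg fun x _ =>
    (mul_nonneg_iff_of_pos_left (Real.exp_pos a)).1 ((hq x).trans (h2 x))
  have hupos : 0 < 1 - u := by
    by_contra h
    have : Real.exp a * (1 - u) ≤ 0 := mul_nonpos_of_nonneg_of_nonpos (Real.exp_pos a).le (not_lt.1 h)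
    linarith
  have k1 := two_mul_sub_le_mul_add hvpos hle huv
  have k2 := two_mul_sub_le_mul_add hupos (by linarith) hvu
  -- With `w = u + v`, `k1` times `2 - w` plus `k2` times `w` gives `4 (u - v) ≤ (a + b) w (2 - w)`.
  have k3 : (u + v) * (2 - (u + v)) ≤ 1 := by nlinarith [sq_nonneg (u + v - 1)]
  have k4 : (a + b) * ((u + v) * (2 - (u + v))) ≤ a + b :=
    mul_le_of_le_one_right (by linarith) k3
  have k5 := mul_le_mul_of_nonneg_right k1 (by linarith : (0 : ℝ) ≤ 2 - (u + v))
  have k6 := mul_le_mul_of_nonneg_right k2 (by linarith : (0 : ℝ) ≤ u + v)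
  linarith

/-- The Bhattacharyya coefficient is at most `√(1 - d_TV²)`. -/
theorem sum_sqrt_mul_le (hp : ∀ x, 0 ≤ p x) (hq : ∀ x, 0 ≤ q x) (hp1 : ∑ x, p x = 1)
    (hq1 : ∑ x, q x = 1) :
    ∑ x, √(p x) * √(q x) ≤ √(1 - ((1 / 2) * ∑ x, |p x - q x|) ^ 2) := by
  apply Real.le_sqrt_of_sq_le
  set r := ∑ x, √(p x) * √(q x) with hr
  -- Cauchy-Schwarz on `|p - q| = |√p - √q| (√p + √q)` yields `(2 d_TV)² ≤ (2 - 2 r) (2 + 2 r)`.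
  have h := Finset.sum_mul_sq_le_sq_mul_sq Finset.univ (fun x => |√(p x) - √(q x)|)
    fun x => √(p x) + √(q x)
  have e0 : ∑ x, |√(p x) - √(q x)| * (√(p x) + √(q x)) = ∑ x, |p x - q x| := by
    refine Finset.sum_congr rfl fun x _ => ?_
    rw [← abs_of_nonneg (by positivity : 0 ≤ √(p x) + √(q x)), ← abs_mul]
    congr 1
    linear_combination Real.sq_sqrt (hp x) - Real.sq_sqrt (hq x)
  have e1 : ∑ x, |√(p x) - √(q x)| ^ 2 = 2 - 2 * r := by
    calc ∑ x, |√(p x) - √(q x)| ^ 2 = ∑ x, (p x + q x - 2 * (√(p x) * √(q x))) := by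
          refine Finset.sum_congr rfl fun x _ => ?_
          rw [sq_abs]
          linear_combination Real.sq_sqrt (hp x) + Real.sq_sqrt (hq x)
      _ = _ := by
          rw [Finset.sum_sub_distrib, Finset.sum_add_distrib, hp1, hq1, ← Finset.mul_sum]; ring
  have e2 : ∑ x, (√(p x) + √(q x)) ^ 2 = 2 + 2 * r := by
    calc ∑ x, (√(p x) + √(q x)) ^ 2 = ∑ x, (p x + q x + 2 * (√(p x) * √(q x))) := by
          refine Finset.sum_congr rfl fun x _ => ?_
          linear_combination Real.sq_sqrt (hp x) + Real.sq_sqrt (hq x)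
      _ = _ := by
          rw [Finset.sum_add_distrib, Finset.sum_add_distrib, hp1, hq1, ← Finset.mul_sum]; ring
  rw [e0, e1, e2] at h
  linarith

theorem tanh_half_eq (ε : ℝ) : Real.tanh (ε / 2) = (Real.exp ε - 1) / (Real.exp ε + 1) := by
  have h : Real.exp ε = Real.exp (ε / 2) * Real.exp (ε / 2) := by rw [← Real.exp_add]; ring_nf
  have := Real.exp_pos (ε / 2)
  rw [Real.tanh_eq, Real.exp_neg, h]
  field_simp

theorem tanh_half_le {ε : ℝ} (hε : 0 ≤ ε) : Real.tanh (ε / 2) ≤ ε / 2 := by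
  rw [tanh_half_eq, div_le_iff₀ (by positivity)]
  have := two_mul_sub_le_mul_add one_pos (Real.one_le_exp hε) (by simp : Real.exp ε ≤ Real.exp ε * 1)
  linarith

end Analysis

/-! ### Rényi divergence and sensitivity in the extended reals -/

section Divergence

variable {X : Type*}

theorem sum_toReal_eq_one [Fintype X] (P : PMF X) : ∑ x, (P x).toReal = 1 := by
  rw [← ENNReal.toReal_sum fun x _ => P.apply_ne_top x, ← tsum_fintype (L := .unconditional _),
    P.tsum_coe, ENNReal.toReal_one]

theorem le_mul_of_renyiDivInf_le {P Q : PMF X} {b : ℝ} (h : renyiDivInf P Q ≤ b) (x : X) :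
    (P x).toReal ≤ Real.exp b * (Q x).toReal := by
  have h1 : ENNReal.log (P x / Q x) ≤ ENNReal.log (ENNReal.ofReal (Real.exp b)) := by
    rw [ENNReal.log_ofReal_of_pos (Real.exp_pos b), Real.log_exp]
    exact (le_iSup (fun x => ENNReal.log (P x / Q x)) x).trans h
  rw [ENNReal.log_le_log_iff] at h1
  have h2 : P x ≤ ENNReal.ofReal (Real.exp b) * Q x :=
    (ENNReal.div_le_iff_le_mul (Or.inr ENNReal.ofReal_ne_top) (Or.inl (Q.apply_ne_top x))).1 h1
  have h3 := ENNReal.toReal_mono (ENNReal.mul_ne_top ENNReal.ofReal_ne_top (Q.apply_ne_top x)) h2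
  rwa [ENNReal.toReal_mul, ENNReal.toReal_ofReal (Real.exp_pos b).le] at h3

variable [Fintype X]

/-- A bound `P ≤ exp b * Q` with `b < 0` would sum to `1 ≤ exp b < 1`. This excludes `⊥` in the sum
defining `sensitivity`. -/
theorem renyiDivInf_nonneg (P Q : PMF X) : 0 ≤ renyiDivInf P Q := by
  by_contra! h
  obtain ⟨b, hb, hb0⟩ := EReal.lt_iff_exists_real_btwn.1 h
  have hb0' : b < 0 := by exact_mod_cast hb0
  have h1 : ∑ x, (P x).toReal ≤ ∑ x, Real.exp b * (Q x).toReal :=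
    Finset.sum_le_sum fun x _ => le_mul_of_renyiDivInf_le hb.le x
  rw [← Finset.mul_sum, sum_toReal_eq_one, sum_toReal_eq_one, mul_one, Real.one_le_exp_iff] at h1
  linarith

theorem four_mul_tvDist_le_sensitivity (P₀ P₁ : PMF X) :
    ((4 * tvDist P₀ P₁ : ℝ) : EReal) ≤ sensitivity P₀ P₁ := by
  have hb := renyiDivInf_nonneg P₁ P₀
  have ha := renyiDivInf_nonneg P₀ P₁
  rw [sensitivity]
  induction hb' : renyiDivInf P₁ P₀ with
  | bot => simp [hb'] at hb
  | top => rw [EReal.top_add_of_ne_bot (ne_bot_of_le_ne_bot EReal.zero_ne_bot ha)]; exact le_top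
  | coe b =>
    induction ha' : renyiDivInf P₀ P₁ with
    | bot => simp [ha'] at ha
    | top => rw [EReal.coe_add_top]; exact le_top
    | coe a =>
      rw [← EReal.coe_add, EReal.coe_le_coe_iff, tvDist]
      have := two_mul_sum_abs_sub_le (sum_toReal_eq_one P₀) (sum_toReal_eq_one P₁)
        (fun x => ENNReal.toReal_nonneg) (le_mul_of_renyiDivInf_le ha'.le)
        (le_mul_of_renyiDivInf_le hb'.le)
      linarith

theorem tvDist_nonneg (P₀ P₁ : PMF X) : 0 ≤ tvDist P₀ P₁ := by
  unfold tvDist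
  positivity

theorem tvDist_le_one (P₀ P₁ : PMF X) : tvDist P₀ P₁ ≤ 1 := by
  have h : ∑ x, |(P₀ x).toReal - (P₁ x).toReal| ≤ ∑ x, ((P₀ x).toReal + (P₁ x).toReal) :=
    Finset.sum_le_sum fun x _ => by
      have h0 : 0 ≤ (P₀ x).toReal := ENNReal.toReal_nonneg
      have h1 : 0 ≤ (P₁ x).toReal := ENNReal.toReal_nonneg
      rw [abs_le]; constructor <;> linarith
  rw [Finset.sum_add_distrib, sum_toReal_eq_one, sum_toReal_eq_one] at h
  unfold tvDist
  linarith

theorem tvDist_eq_zero_of_subsingleton [Subsingleton X] (P₀ P₁ : PMF X) : tvDist P₀ P₁ = 0 := by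
  have : P₀ = P₁ := by
    obtain ⟨x, -⟩ := P₀.support_nonempty
    have h0 := P₀.tsum_coe
    have h1 := P₁.tsum_coe
    rw [tsum_eq_single x fun y hy => (hy (Subsingleton.elim _ _)).elim] at h0 h1
    ext y
    rw [Subsingleton.elim y x, h0, h1]
  simp [tvDist, this]

end Divergence

/-! ### Contraction and privacy of randomized response -/

section RandomizedResponse

variable {X : Type*} [Fintype X] [DecidableEq X]

/-- The output law is affine in `P` with a common constant term, so differences of laws are scaled
by exactly the slope. -/
theorem bind_randomizedResponse_toReal (ε : ℝ) (P : PMF X) (y : X) :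
    (P.bind (randomizedResponse ε) y).toReal = 1 / (Real.exp ε + Fintype.card X - 1) +
      (Real.exp ε - 1) / (Real.exp ε + Fintype.card X - 1) * (P y).toReal := by
  rw [PMF.bind_apply, tsum_fintype, ENNReal.toReal_sum fun x _ => ENNReal.mul_ne_top
    (P.apply_ne_top x) (PMF.apply_ne_top _ _)]
  have h : ∀ x, (P x * randomizedResponse ε x y).toReal =
      (P x).toReal * (1 / (Real.exp ε + Fintype.card X - 1)) +
      (if y = x then (P x).toReal * ((Real.exp ε - 1) / (Real.exp ε + Fintype.card X - 1))
        else 0) := by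
    intro x
    rw [ENNReal.toReal_mul, randomizedResponse, PMF.ofFintype_apply,
      ENNReal.toReal_ofReal (rrProb_nonneg ε x y), rrProb]
    split_ifs
    · ring
    · ring
  simp_rw [h]
  rw [Finset.sum_add_distrib, ← Finset.sum_mul, sum_toReal_eq_one, Finset.sum_ite_eq]
  simp only [Finset.mem_univ, if_true]
  ring

theorem tvDist_bind_randomizedResponse {ε : ℝ} (hε : 0 ≤ ε) (P₀ P₁ : PMF X) :
    tvDist (P₀.bind (randomizedResponse ε)) (P₁.bind (randomizedResponse ε)) =
      (Real.exp ε - 1) / (Real.exp ε + Fintype.card X - 1) * tvDist P₀ P₁ := by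
  obtain ⟨x, -⟩ := P₀.support_nonempty
  have h : 0 ≤ (Real.exp ε - 1) / (Real.exp ε + Fintype.card X - 1) :=
    div_nonneg (sub_nonneg.2 (Real.one_le_exp hε)) (rr_denom_pos ε x).le
  simp only [tvDist, bind_randomizedResponse_toReal, add_sub_add_left_eq_sub, ← mul_sub, abs_mul,
    abs_of_nonneg h, ← Finset.mul_sum]
  ring

theorem cR_eq {ε : ℝ} (hε : 0 ≤ ε) (P₀ P₁ : PMF X) : cR ε P₀ P₁ =
    2 * tvDist (P₀.bind (randomizedResponse ε)) (P₁.bind (randomizedResponse ε)) ^ 2 := by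
  rw [tvDist_bind_randomizedResponse hε, cR]
  ring

/-- The contraction factor decreases in `q` and equals `tanh (ε / 2)` at `q = 2`; for `q = 1` both
distances vanish. -/
theorem tvDist_bind_randomizedResponse_le {ε : ℝ} (hε : 0 ≤ ε) (P₀ P₁ : PMF X) :
    tvDist (P₀.bind (randomizedResponse ε)) (P₁.bind (randomizedResponse ε)) ≤
      Real.tanh (ε / 2) * tvDist P₀ P₁ := by
  rw [tvDist_bind_randomizedResponse hε]
  rcases subsingleton_or_nontrivial X with _ | _
  · rw [tvDist_eq_zero_of_subsingleton]; simp
  · have h2 : (2 : ℝ) ≤ Fintype.card X := by exact_mod_cast Fintype.one_lt_card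
    have h1 := Real.one_le_exp hε
    rw [tanh_half_eq]
    refine mul_le_mul_of_nonneg_right ?_ (tvDist_nonneg _ _)
    exact div_le_div_of_nonneg_left (by linarith) (by linarith) (by linarith)

/-- After the contraction by `tanh (ε / 2)`, the bound `2 ε` uses `d_TV ≤ 1` and `tanh (ε / 2) ≤ ε /
2`, the other one `4 d_TV ≤ s`. -/
theorem four_mul_tvDist_le_sR {ε : ℝ} (hε : 0 < ε) (P₀ P₁ : PMF X) :
    4 * tvDist (P₀.bind (randomizedResponse ε)) (P₁.bind (randomizedResponse ε)) ≤
      sR ε P₀ P₁ := by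
  set T := tvDist (P₀.bind (randomizedResponse ε)) (P₁.bind (randomizedResponse ε)) with hT
  have hT0 : 0 ≤ T := tvDist_nonneg _ _
  have hle : T ≤ Real.tanh (ε / 2) * tvDist P₀ P₁ := tvDist_bind_randomizedResponse_le hε.le P₀ P₁
  have htanh : 0 ≤ Real.tanh (ε / 2) := by
    rw [tanh_half_eq]
    have := Real.one_le_exp hε.le
    exact div_nonneg (by linarith) (by linarith)
  have key : ((4 * T : ℝ) : EReal) ≤
      min ((2 * ε : ℝ) : EReal) ((Real.tanh (ε / 2) : ℝ) * sensitivity P₀ P₁) := by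
    refine le_min (EReal.coe_le_coe_iff.2 ?_) ?_
    · have h1 := mul_le_of_le_one_right htanh (tvDist_le_one P₀ P₁)
      have h2 := tanh_half_le hε.le
      linarith
    · calc ((4 * T : ℝ) : EReal) ≤ ((Real.tanh (ε / 2) * (4 * tvDist P₀ P₁) : ℝ) : EReal) :=
          EReal.coe_le_coe_iff.2 (by linarith)
        _ = (Real.tanh (ε / 2) : ℝ) * ((4 * tvDist P₀ P₁ : ℝ) : EReal) := EReal.coe_mul _ _
        _ ≤ _ := mul_le_mul_of_nonneg_left (four_mul_tvDist_le_sensitivity P₀ P₁)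
          (EReal.coe_nonneg.2 htanh)
  have h := EReal.toReal_le_toReal key (EReal.coe_ne_bot _)
    (ne_top_of_le_ne_top (EReal.coe_ne_top _) (min_le_left _ _))
  rwa [EReal.toReal_coe] at h

theorem isLDP_randomizedResponse {ε : ℝ} (hε : 0 ≤ ε) :
    IsLDP ε (randomizedResponse (X := X) ε) := by
  intro x x' S
  rw [PMF.toOuterMeasure_apply, PMF.toOuterMeasure_apply, ← ENNReal.tsum_mul_left]
  refine ENNReal.tsum_le_tsum fun y => ?_
  by_cases hy : y ∈ S
  · rw [Set.indicator_of_mem hy, Set.indicator_of_mem hy, randomizedResponse, randomizedResponse,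
      PMF.ofFintype_apply, PMF.ofFintype_apply, ← ENNReal.ofReal_mul (Real.exp_pos ε).le]
    refine ENNReal.ofReal_le_ofReal ?_
    have hd := rr_denom_pos ε x
    have h1 := Real.one_le_exp hε
    unfold rrProb
    split_ifs <;> rw [← mul_div_assoc] <;> gcongr <;> nlinarith
  · simp [Set.indicator_of_notMem hy]

end RandomizedResponse

end LocalCPD

namespace LocalCPD

open MeasureTheory

/-! ### One-sided deviation of a log-likelihood ratio walk -/

section OneSided

variable {X : Type*} [Fintype X]

theorem tvDist_comm (P Q : PMF X) : tvDist P Q = tvDist Q P := by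
  simp only [tvDist, abs_sub_comm]

variable [MeasurableSpace X] [MeasurableSingletonClass X]

/-- Tilting by 1/2 turns the mean of the likelihood ratio into the Bhattacharyya coefficient, which
is symmetric and so serves both walks. -/
theorem lintegral_exp_half_log_div_le {P Q : PMF X} (hP : ∀ x, 0 < (P x).toReal)
    (hQ : ∀ x, 0 < (Q x).toReal) :
    ∫⁻ t, ENNReal.ofReal (Real.exp (1 / 2 * Real.log ((P t).toReal / (Q t).toReal))) ∂Q.toMeasure ≤
      ENNReal.ofReal (√(1 - tvDist P Q ^ 2)) := by
  rw [lintegral_fintype]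
  have h : ∀ t, ENNReal.ofReal (Real.exp (1 / 2 * Real.log ((P t).toReal / (Q t).toReal))) *
      Q.toMeasure {t} = ENNReal.ofReal (√(P t).toReal * √(Q t).toReal) := by
    intro t
    rw [PMF.toMeasure_apply_singleton _ _ (measurableSet_singleton _),
      ← ENNReal.ofReal_toReal (Q.apply_ne_top t), ← ENNReal.ofReal_mul (Real.exp_pos _).le,
      ENNReal.toReal_ofReal ENNReal.toReal_nonneg]
    congr 1
    rw [mul_comm (1 / 2 : ℝ), ← Real.rpow_def_of_pos (div_pos (hP t) (hQ t)), ← Real.sqrt_eq_rpow,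
      Real.sqrt_div (hP t).le]
    have := Real.sqrt_pos.2 (hQ t)
    field_simp
    rw [Real.sq_sqrt (hQ t).le]
  simp_rw [h]
  rw [← ENNReal.ofReal_sum_of_nonneg fun t _ => by positivity]
  exact ENNReal.ofReal_le_ofReal (sum_sqrt_mul_le (fun _ => ENNReal.toReal_nonneg)
    (fun _ => ENNReal.toReal_nonneg) (sum_toReal_eq_one P) (sum_toReal_eq_one Q))

/-- A log-likelihood ratio walk with negative drift is rarely nonnegative at some time `≥ a`. -/
theorem measure_exists_sum_log_nonneg_le {ι : Type*} [Fintype ι] {P Q : PMF X}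
    (hP : ∀ x, 0 < (P x).toReal) (hQ : ∀ x, 0 < (Q x).toReal) (p : ι → PMF X) {e : ℕ → ι}
    (a : ℕ) {M : ℕ} (he : Set.InjOn e (Set.Iio M)) (hp : ∀ m < M, p (e m) = Q) :
    Measure.pi (fun i => (p i).toMeasure) {y | ∃ m, a ≤ m ∧ m ≤ M ∧
        0 ≤ ∑ j ∈ Finset.range m, Real.log ((P (y (e j))).toReal / (Q (y (e j))).toReal)} ≤
      ENNReal.ofReal (√(1 - tvDist P Q ^ 2)) ^ a := by
  refine (measure_mono ?_).trans (measure_exists_one_le_prod_le (fun i => (p i).toMeasure)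
    (g := fun t => ENNReal.ofReal (Real.exp (1 / 2 * Real.log ((P t).toReal / (Q t).toReal))))
    (e := e) (M := M) ?_ he ?_)
  · rintro y ⟨m, h1, h2, h3⟩
    refine ⟨m, h1, h2, ?_⟩
    rw [← ENNReal.ofReal_prod_of_nonneg fun _ _ => (Real.exp_pos _).le, ← Real.exp_sum,
      ← Finset.mul_sum, ENNReal.one_le_ofReal, Real.one_le_exp_iff]
    positivity
  · rw [ENNReal.ofReal_le_one]
    exact Real.sqrt_le_one.2 (by linarith [sq_nonneg (tvDist P Q)])
  · intro m hm
    simp only [hp m hm]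
    exact lintegral_exp_half_log_div_le hP hQ

end OneSided

/-! ### Error event of the maximum likelihood estimator -/

section Estimator

variable {X : Type*}

theorem logLR_sub_logLR_succ {n : ℕ} (Q₀ Q₁ : PMF X) (y : Fin n → X) (i : Fin n) :
    logLR Q₀ Q₁ y (i + 1) - logLR Q₀ Q₁ y (i + 2) =
      Real.log ((Q₁ (y i)).toReal / (Q₀ (y i)).toReal) := by
  rw [logLR, logLR, ← Finset.sum_sub_distrib, Finset.sum_eq_single i]
  · simp
  · intro j _ hj
    have : (j : ℕ) ≠ i := fun h => hj (Fin.ext h)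
    split_ifs <;> first | omega | simp
  · simp

theorem logLR_sub_logLR_add {n : ℕ} [NeZero n] (Q₀ Q₁ : PMF X) (y : Fin n → X) {k m : ℕ}
    (h : k + m ≤ n) : logLR Q₀ Q₁ y (k + 1) - logLR Q₀ Q₁ y (k + 1 + m) =
      ∑ j ∈ Finset.range m, Real.log ((Q₁ (y (Fin.ofNat n (k + j)))).toReal /
        (Q₀ (y (Fin.ofNat n (k + j)))).toReal) := by
  induction m with
  | zero => simp
  | succ m ih =>
    have h1 := logLR_sub_logLR_succ Q₀ Q₁ y (Fin.ofNat n (k + m))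
    have h2 : ((Fin.ofNat n (k + m) : Fin n) : ℕ) = k + m := Nat.mod_eq_of_lt (by omega)
    rw [h2] at h1
    rw [Finset.sum_range_succ, ← ih (by omega), ← h1]
    rw [show k + 1 + (m + 1) = k + m + 2 by ring, show k + 1 + m = k + m + 1 by ring]
    ring

/-- The sum is reversed so that the time `j` of the walk moves leftwards, away from the
change-point. -/
theorem logLR_sub_sub_logLR {n : ℕ} [NeZero n] (Q₀ Q₁ : PMF X) (y : Fin n → X) {k m : ℕ}
    (hk : k < n) (h : m ≤ k) : logLR Q₀ Q₁ y (k + 1 - m) - logLR Q₀ Q₁ y (k + 1) =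
      ∑ j ∈ Finset.range m, Real.log ((Q₁ (y (Fin.ofNat n (k - 1 - j)))).toReal /
        (Q₀ (y (Fin.ofNat n (k - 1 - j)))).toReal) := by
  have h1 := logLR_sub_logLR_add Q₀ Q₁ y (show k - m + m ≤ n by omega)
  rw [show k - m + 1 + m = k + 1 by omega, show k - m + 1 = k + 1 - m by omega] at h1
  rw [h1, ← Finset.sum_range_reflect]
  refine Finset.sum_congr rfl fun j hj => ?_
  rw [Finset.mem_range] at hj
  rw [show k - m + (m - 1 - j) = k - 1 - j by omega]

variable [Fintype X] [MeasurableSpace X] [MeasurableSingletonClass X]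

/-- Error bound for the offline estimator in terms of the total variation distance. -/
theorem measure_offlineCPD_error_le {n kstar : ℕ} (α : ℕ) {Q₀ Q₁ : PMF X}
    (hQ₀ : ∀ x, 0 < (Q₀ x).toReal) (hQ₁ : ∀ x, 0 < (Q₁ x).toReal) {khat : (Fin n → X) → ℕ}
    (hkhat : IsOfflineCPD Q₀ Q₁ khat) (hk : kstar ∈ Set.Ioc 1 n) :
    Measure.pi (fun i : Fin n => (if (i : ℕ) + 1 < kstar then Q₀ else Q₁).toMeasure)
      {y | (khat y : ℤ) ∉ Set.Icc ((kstar : ℤ) - α) ((kstar : ℤ) + α)} ≤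
      2 * ENNReal.ofReal (√(1 - tvDist Q₀ Q₁ ^ 2)) ^ (α + 1) := by
  obtain ⟨hk1, hkn⟩ := hk
  obtain ⟨k, rfl⟩ : ∃ k, kstar = k + 1 := ⟨kstar - 1, by omega⟩
  have : NeZero n := ⟨by omega⟩
  have hval : ∀ j < n, ((Fin.ofNat n j : Fin n) : ℕ) = j := fun j hj => Nat.mod_eq_of_lt hj
  -- With `kstar = k + 1`, the coordinates `k, …, n - 1` have law `Q₁` and `k - 1, …, 0` have law
  -- `Q₀`. All indices used stay below `n`, so the reduction mod `n` in `Fin.ofNat` is harmless.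
  have hR := measure_exists_sum_log_nonneg_le hQ₀ hQ₁
    (fun i : Fin n => if (i : ℕ) + 1 < k + 1 then Q₀ else Q₁)
    (e := fun j => Fin.ofNat n (k + j)) (α + 1) (M := n - k)
    (by
      intro i hi j hj hij
      simp only [Set.mem_Iio] at hi hj
      have h := congrArg Fin.val hij
      rw [hval _ (by omega), hval _ (by omega)] at h
      omega)
    (by
      intro m hm
      simp only [hval (k + m) (by omega)]
      exact if_neg (by omega))
  have hL := measure_exists_sum_log_nonneg_le hQ₁ hQ₀
    (fun i : Fin n => if (i : ℕ) + 1 < k + 1 then Q₀ else Q₁)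
    (e := fun j => Fin.ofNat n (k - 1 - j)) (α + 1) (M := k)
    (by
      intro i hi j hj hij
      simp only [Set.mem_Iio] at hi hj
      have h := congrArg Fin.val hij
      rw [hval _ (by omega), hval _ (by omega)] at h
      omega)
    (by
      intro m hm
      simp only [hval (k - 1 - m) (by omega)]
      exact if_pos (by omega))
  rw [tvDist_comm] at hL
  rw [two_mul]
  refine (measure_mono ?_).trans ((measure_union_le _ _).trans (add_le_add hR hL))
  intro y hy
  obtain ⟨hmem, hmax⟩ := hkhat y
  have hmax' := hmax (k + 1) ⟨by omega, hkn⟩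
  simp only [Set.mem_Icc, Set.mem_ofPred_eq, not_and_or, not_le] at hy hmem
  rcases lt_or_ge (k + 1) (khat y) with h | h
  · left
    refine ⟨khat y - (k + 1), by omega, by omega, ?_⟩
    have h1 := logLR_sub_logLR_add Q₀ Q₁ y (show k + (khat y - (k + 1)) ≤ n by omega)
    rw [show k + 1 + (khat y - (k + 1)) = khat y by omega] at h1
    have h2 : ∀ x, Real.log ((Q₀ x).toReal / (Q₁ x).toReal) =
        -Real.log ((Q₁ x).toReal / (Q₀ x).toReal) := fun x => by rw [← Real.log_inv, inv_div]
    simp only [h2, Finset.sum_neg_distrib]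
    linarith
  · right
    refine ⟨k + 1 - khat y, by omega, by omega, ?_⟩
    have h1 := logLR_sub_sub_logLR Q₀ Q₁ y (show k < n by omega)
      (show k + 1 - khat y ≤ k by omega)
    rw [show k + 1 - (k + 1 - khat y) = khat y by omega] at h1
    linarith

end Estimator

/-! ### Comparison with the stated bound -/

theorem le_of_iStar_eq_zero {n α : ℕ} (hn : 1 < n) (hα : 1 ≤ α) (h : iStar n α = 0) :
    n ≤ α + 1 := by
  rw [iStar, Nat.ceil_eq_zero] at h
  have hn' : (1 : ℝ) < n := by exact_mod_cast hn
  have hα' : (0 : ℝ) < α := by exact_mod_cast hα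
  have h1 := (Real.logb_nonpos_iff one_lt_two (div_pos (by linarith) hα')).1 h
  rw [div_le_one hα'] at h1
  have : (n : ℝ) ≤ (α + 1 : ℕ) := by push_cast; linarith
  exact_mod_cast this

/-- Here `1 - T² ≤ exp (-T²)`, while `s ≥ 4 T` makes `(2 T²)² / s² ≤ T² / 4`, within the available
`T² / 2`. -/
theorem one_sub_sq_rpow_le_exp {T s α : ℝ} (hT0 : 0 ≤ T) (hT1 : T ≤ 1) (hα : 0 ≤ α)
    (hs : 4 * T ≤ s) :
    (1 - T ^ 2) ^ (α / 2) ≤ Real.exp (-(α * (2 * T ^ 2) ^ 2) / s ^ 2) := by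
  calc (1 - T ^ 2) ^ (α / 2) ≤ Real.exp (-T ^ 2) ^ (α / 2) := by
        refine Real.rpow_le_rpow (by nlinarith) ?_ (by positivity)
        linarith [Real.add_one_le_exp (-T ^ 2)]
    _ = Real.exp (-T ^ 2 * (α / 2)) := (Real.exp_mul _ _).symm
    _ ≤ _ := by
        rw [Real.exp_le_exp]
        -- For `T = 0`, `s` may vanish; the quotient is then `0 / 0 = 0`.
        rcases hT0.eq_or_lt with rfl | hT
        · simp
        · have hs2 : (4 * T) ^ 2 ≤ s ^ 2 := by gcongr
          rw [neg_div, neg_mul, neg_le_neg_iff, div_le_iff₀ (by nlinarith)]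
          have h2 : 0 ≤ α * T ^ 2 := by positivity
          nlinarith [mul_le_mul_of_nonneg_left hs2 h2, mul_nonneg h2 (sq_nonneg T)]

end LocalCPD

theorem theorem5p7 {X : Type*} [Fintype X] [DecidableEq X] [MeasurableSpace X]
    [MeasurableSingletonClass X] (ε : ℝ) (hε : 0 < ε) (P₀ P₁ : PMF X) (n : ℕ)
    (A : LocalCPD.Algorithm X X n) (hA : LocalCPD.IsRRCPD ε P₀ P₁ A) :
    A.IsLDP ε ∧
      ∀ kstar ∈ Set.Ioc 1 n, ∀ α ∈ Set.Icc 1 n, ∃ β : ℝ,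
        A.IsAccurate P₀ P₁ kstar α β ∧
          β ≤ 2 * min
            (∑ i ∈ Finset.Icc 1 (LocalCPD.iStar n α),
              Real.exp (-(2 ^ (i - 1) * (α : ℝ) * LocalCPD.cR ε P₀ P₁ ^ 2) /
                LocalCPD.sR ε P₀ P₁ ^ 2))
            ((1 - LocalCPD.cR ε P₀ P₁ / 2) ^ ((α : ℝ) / 2)) := by
  open LocalCPD MeasureTheory in
  obtain ⟨hpriv, hest⟩ := hA
  refine ⟨by rw [Algorithm.IsLDP, hpriv]; exact isLDP_randomizedResponse hε.le, ?_⟩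
  intro kstar hk α hα
  refine ⟨_, rfl, ?_⟩
  rw [privatizedLaw_eq_pi, hpriv, cR_eq hε.le]
  have hs := four_mul_tvDist_le_sR hε P₀ P₁
  set Q₀ := P₀.bind (randomizedResponse ε)
  set Q₁ := P₁.bind (randomizedResponse ε)
  set T := tvDist Q₀ Q₁
  have hpos : ∀ (P : PMF X) (x : X), 0 < (P.bind (randomizedResponse ε) x).toReal := by
    intro P x
    rw [bind_randomizedResponse_toReal]
    have hd := rr_denom_pos ε x
    have h1 := sub_nonneg.2 (Real.one_le_exp hε.le)
    positivity
  have hT0 : 0 ≤ T := tvDist_nonneg _ _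
  have hT1 : T ≤ 1 := tvDist_le_one _ _
  have hT2 : 0 ≤ 1 - T ^ 2 := by nlinarith
  set E := {y : Fin n → X | (A.estimator y : ℤ) ∉
    Set.Icc ((kstar : ℤ) - α) ((kstar : ℤ) + α)} with hE
  set ν := Measure.pi fun i : Fin n => (if (i : ℕ) + 1 < kstar then Q₀ else Q₁).toMeasure
  have hbound : ν.real E ≤ 2 * (1 - T ^ 2) ^ ((α : ℝ) / 2) := by
    have h := measure_offlineCPD_error_le α (hpos P₀) (hpos P₁) hest hk
    rw [← ENNReal.ofReal_pow (Real.sqrt_nonneg _), ← ENNReal.ofReal_ofNat,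
      ← ENNReal.ofReal_mul zero_le_two] at h
    calc ν.real E ≤ 2 * √(1 - T ^ 2) ^ (α + 1) :=
          ENNReal.toReal_le_of_le_ofReal (by positivity) h
      _ ≤ 2 * √(1 - T ^ 2) ^ α := by
          refine mul_le_mul_of_nonneg_left (pow_le_pow_of_le_one (Real.sqrt_nonneg _) ?_
            α.le_succ) zero_le_two
          exact Real.sqrt_le_one.2 (by linarith [sq_nonneg T])
      _ = 2 * (1 - T ^ 2) ^ ((α : ℝ) / 2) := by
          rw [Real.sqrt_eq_rpow, ← Real.rpow_natCast, ← Real.rpow_mul hT2]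
          ring_nf
  rw [mul_div_cancel_left₀ _ (two_ne_zero (α := ℝ)), mul_min_of_nonneg _ _ zero_le_two]
  refine le_min ?_ hbound
  rcases Nat.eq_zero_or_pos (iStar n α) with h0 | h0
  -- Now `n - 1 ≤ α`, so no estimate in `{1, …, n}` can miss by more than `α`.
  · have hn := le_of_iStar_eq_zero (hk.1.trans_le hk.2) hα.1 h0
    have : E = ∅ := by
      ext y
      have h1 := (hest y).1
      have h2 := hk
      simp only [Set.mem_Icc, Set.mem_Ioc] at h1 h2
      simp only [hE, Set.mem_Icc, Set.mem_ofPred_eq, Set.mem_empty_iff_false, iff_false, not_not]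
      omega
    simp [this, h0]
  · refine hbound.trans (mul_le_mul_of_nonneg_left ?_ zero_le_two)
    refine (one_sub_sq_rpow_le_exp hT0 hT1 α.cast_nonneg hs).trans ?_
    -- Only the summand `i = 1`, where `2 ^ (i - 1) = 1`, is kept.
    refine le_trans (le_of_eq ?_) (Finset.single_le_sum (f := fun i =>
      Real.exp (-(2 ^ (i - 1) * (α : ℝ) * (2 * T ^ 2) ^ 2) / sR ε P₀ P₁ ^ 2))
      (fun _ _ => (Real.exp_pos _).le) (Finset.mem_Icc.2 ⟨le_rfl, h0⟩))
    simp
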